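/- Let $N\ge 1$ and let $j:\mathbb{R}^N\to[0,\infty]$ be an even measurable kernel such that (j1) $\displaystyle\int_{\mathbb{R}^N}\min\{1,|z|^2\}\,j(z)\,dz<\infty$; (j2) for every $r>0$, $j$ does not vanish a.e. in the ball $B_r(0)$. Let $\Omega\subset\mathbb{R}^N$ be a domain (a nonempty connected open set), and let $c\in L^\infty_{loc}(\Omega)$. Let $V^j_{loc}(\Omega)$ be the space of all $u\in L^2_{loc}(\mathbb{R}^N)$ such that $$\int_{\Omega'}\int_{\mathbb{R}^N}(u(x)-u(y))^2 j(x-y)\,dx\,dy<\infty$$ for every measurable set $\Omega'$ whose closure is compact and contained in $\Omega$. Suppose that $u\in V^j_{loc}(\Omega)$ satisfies $u\ge 0$ a.e. on $\mathbb{R}^N$ and is a weak supersolution in $\Omega$ of the equation $Iu=c(x)u$, where formally $Iu(x)=\mathrm{P.V.}\int_{\mathbb{R}^N}(u(x)-u(y))j(x-y)\,dy$; that is, $$\frac12\int_{\mathbb{R}^N}\int_{\mathbb{R}^N}(u(x)-u(y))(\varphi(x)-\varphi(y))\,j(x-y)\,dx\,dy\;\ge\;\int_\Omega c(x)\,u(x)\,\varphi(x)\,dx\qquad\text{for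 all }\varphi\in C_c^\infty(\Omega),\ \varphi\ge 0.$$ Then either $u=0$ a.e. in $\Omega$, or $\operatorname{ess\,inf}_K u>0$ for every compact subset $K\subset\Omega$ (where the essential infimum over a null set is $+\infty$). -/

import Mathlib

open MeasureTheory Set
open scoped ENNReal

noncomputable section

/-- The Lévy type integrability condition on a kernel `j : ℝ^N → [0,∞]`: `j` is even, (Lebesgue)
measurable, and `∫ min(1,|z|²) j(z) dz < ∞`. -/
structure LevyKernel {N : ℕ} (j : EuclideanSpace ℝ (Fin N) → ℝ≥0∞) : Prop where
  even : ∀ z, j (-z) = j z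
  aemeasurable : AEMeasurable j volume
  lintegral_lt_top : ∫⁻ z, ENNReal.ofReal (min 1 (‖z‖ ^ 2)) * j z < ∞

/-- The nontriviality condition: `j` does not vanish a.e. on any ball `B_r(0)`, `r > 0`. -/
def NontrivialNearZero {N : ℕ} (j : EuclideanSpace ℝ (Fin N) → ℝ≥0∞) : Prop :=
  ∀ r : ℝ, 0 < r → ¬ ∀ᵐ z ∂(volume.restrict (Metric.ball (0 : EuclideanSpace ℝ (Fin N)) r)), j z = 0

/-- `f ∈ L^p_loc(Ω)`, for a set `Ω ⊆ ℝ^N` and a function `f` of which only the values on `Ω` are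
relevant. -/
def MemLpLocOn {N : ℕ} (f : EuclideanSpace ℝ (Fin N) → ℝ) (p : ℝ≥0∞)
    (Ω : Set (EuclideanSpace ℝ (Fin N))) : Prop :=
  ∀ K : Set (EuclideanSpace ℝ (Fin N)), IsCompact K → K ⊆ Ω → MemLp f p (volume.restrict K)

/-- The space `V^j_loc(Ω)`: functions `u ∈ L²_loc(ℝ^N)` such that
`∫_{Ω'} ∫_{ℝ^N} (u(x) - u(y))² j(x - y) dy dx < ∞` for every (measurable) `Ω'` whose closure is
compact and contained in `Ω`. -/
def MemVLoc {N : ℕ} (j : EuclideanSpace ℝ (Fin N) → ℝ≥0∞) (Ω : Set (EuclideanSpace ℝ (Fin N)))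
    (u : EuclideanSpace ℝ (Fin N) → ℝ) : Prop :=
  MemLpLocOn u 2 univ ∧
  ∀ Ω' : Set (EuclideanSpace ℝ (Fin N)), MeasurableSet Ω' → IsCompact (closure Ω') →
    closure Ω' ⊆ Ω →
    ∫⁻ x in Ω', ∫⁻ y, ENNReal.ofReal ((u x - u y) ^ 2) * j (x - y) < ∞

/-- The bilinear form
`E_j(u,v) = 1/2 ∫∫ (u(x) - u(y)) (v(x) - v(y)) j(x - y) dx dy`, as a Lebesgue integral over
`ℝ^N × ℝ^N`. A kernel satisfying the Lévy condition is finite a.e., so that `toReal` does not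
change the integral; the integrand is integrable for `u ∈ V^j_loc(Ω)` and `v ∈ C_c^∞(Ω)`. -/
def energyForm {N : ℕ} (j : EuclideanSpace ℝ (Fin N) → ℝ≥0∞)
    (u v : EuclideanSpace ℝ (Fin N) → ℝ) : ℝ :=
  (1 / 2 : ℝ) * ∫ p : EuclideanSpace ℝ (Fin N) × EuclideanSpace ℝ (Fin N),
    (u p.1 - u p.2) * (v p.1 - v p.2) * (j (p.1 - p.2)).toReal

/-- `u` is a weak supersolution of `I u = c(x) u` in `Ω`: it belongs to `V^j_loc(Ω)` and
`E_j(u,φ) ≥ ∫_Ω c u φ dx` for all nonnegative `φ ∈ C_c^∞(Ω)`. -/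
def IsWeakSupersolution {N : ℕ} (j : EuclideanSpace ℝ (Fin N) → ℝ≥0∞)
    (c : EuclideanSpace ℝ (Fin N) → ℝ) (Ω : Set (EuclideanSpace ℝ (Fin N)))
    (u : EuclideanSpace ℝ (Fin N) → ℝ) : Prop :=
  MemVLoc j Ω u ∧
  ∀ φ : EuclideanSpace ℝ (Fin N) → ℝ, ContDiff ℝ (⊤ : ℕ∞) φ → HasCompactSupport φ → tsupport φ ⊆ Ω →
    (∀ x, 0 ≤ φ x) → ∫ x in Ω, c x * u x * φ x ≤ energyForm j u φ

/-- `u` is strictly positive in `Ω`: `ess inf_K u > 0` for every compact `K ⊆ Ω`. The essential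
infimum is taken in the extended reals (it is `+∞` if `K` is a null set). -/
def StrictlyPositiveOn {N : ℕ} (u : EuclideanSpace ℝ (Fin N) → ℝ)
    (Ω : Set (EuclideanSpace ℝ (Fin N))) : Prop :=
  ∀ K : Set (EuclideanSpace ℝ (Fin N)), IsCompact K → K ⊆ Ω →
    0 < essInf (fun x => (u x : EReal)) (volume.restrict K)

end

/-! The dichotomy is local: every point of `Ω` has a neighbourhood where `u` vanishes a.e. or one
where `u` is essentially bounded below by a positive constant. The two sets of points are open and
disjoint, so connectedness selects one, and compactness turns local lower bounds into bounds on
compact sets.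

The local lower bound (`IsWeakSupersolution.exists_pos_le_near`) uses a barrier. Testing with a
reflected mollifier `η (x - ·)` turns the weak inequality into a pointwise one for the continuous
function `U = u ⋆ η`: half the integral of its second differences against `j` is at least `-C * U
x`. Let `A` be a compact set on which `a ≤ j ≤ b`, and suppose that `u` has positive integral over
`x₀ + A`. If `U - δψ`, with `ψ` a bump at `x₀`, had a negative minimum, then at that point the
nonlocal operator would be at most a multiple of `δ` minus a fixed positive amount coming from `A`,
which is impossible for small `δ`. The choice of `δ` does not depend on `η`, so the bound passes to
`u` as the mollifiers concentrate.

If no lower bound holds near `x`, then `u = 0` a.e. on `x + A`. Hence a.e. point of `x + A` also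
lacks a lower bound, and the barrier argument with `-A` shows that `u` has zero integral over `x + z
- A` for a.e. `z ∈ A`. A Steinhaus argument (`exists_ball_ae_eq_zero`) then gives `u = 0` a.e. near
`x`. -/

/-! ### Difference estimates for smooth compactly supported functions. -/

section Differences

variable {E : Type*} [NormedAddCommGroup E] [NormedSpace ℝ E]

/-- The second differences of a compactly supported `C²` function are controlled by
`min 1 ‖z‖²`. -/
theorem exists_abs_secondDiff_le {ψ : E → ℝ} (hψ : ContDiff ℝ 2 ψ) (hc : HasCompactSupport ψ) :
    ∃ M : ℝ, 0 ≤ M ∧ ∀ x z, |2 * ψ x - ψ (x - z) - ψ (x + z)| ≤ M * min 1 (‖z‖ ^ 2) := by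
  obtain ⟨B, hB⟩ := hc.exists_bound_of_continuous hψ.continuous
  have hB0 : 0 ≤ B := (norm_nonneg _).trans (hB 0)
  have hdiff : Differentiable ℝ ψ := hψ.differentiable (by simp)
  obtain ⟨L, hL⟩ := ContDiff.lipschitzWith_of_hasCompactSupport (𝕂 := ℝ) (n := 1) (hc.fderiv ℝ)
    (hψ.fderiv_right (by norm_num)) (by simp)
  refine ⟨4 * B + 2 * L, by positivity, fun x z => ?_⟩
  have h1 : |2 * ψ x - ψ (x - z) - ψ (x + z)| ≤ 4 * B := by
    have a := abs_le.1 (hB x)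
    have b := abs_le.1 (hB (x - z))
    have c := abs_le.1 (hB (x + z))
    rw [abs_le]
    constructor <;> linarith [a.1, a.2, b.1, b.2, c.1, c.2]
  have h2 : |2 * ψ x - ψ (x - z) - ψ (x + z)| ≤ 2 * L * ‖z‖ ^ 2 := by
    -- The derivative of `y ↦ ψ (x - y) + ψ (x + y)` is a difference of values of `fderiv ℝ ψ` at
    -- points `2 * y` apart, hence at most `2 * L * ‖z‖` on the ball; the mean value inequality
    -- supplies the second factor `‖z‖`.
    have key := (convex_closedBall (0 : E) ‖z‖).norm_image_sub_le_of_norm_hasFDerivWithin_le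
      (f := fun y => ψ (x - y) + ψ (x + y))
      (f' := fun y => (fderiv ℝ ψ (x - y)).comp (-ContinuousLinearMap.id ℝ E) + fderiv ℝ ψ (x + y))
      (C := 2 * L * ‖z‖) (x := 0) (y := z) ?_ ?_ (by simp) (by simp)
    · rw [Real.norm_eq_abs, abs_sub_comm] at key
      simp only [sub_zero, add_zero] at key
      calc _ = |ψ x + ψ x - (ψ (x - z) + ψ (x + z))| := by congr 1; ring
        _ ≤ _ := key
        _ = _ := by ring
    · intro y _
      apply HasFDerivAt.hasFDerivWithinAt
      apply HasFDerivAt.add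
      · exact (hdiff (x - y)).hasFDerivAt.comp y ((hasFDerivAt_id y).const_sub x)
      · have := (hdiff (x + y)).hasFDerivAt.comp y ((hasFDerivAt_id y).const_add x)
        simpa using! this
    · intro y hy
      rw [mem_closedBall_zero_iff] at hy
      have : (fderiv ℝ ψ (x - y)).comp (-ContinuousLinearMap.id ℝ E) + fderiv ℝ ψ (x + y)
          = fderiv ℝ ψ (x + y) - fderiv ℝ ψ (x - y) := by
        ext v; simp; ring
      rw [this, ← dist_eq_norm]
      calc _ ≤ L * dist (x + y) (x - y) := hL.dist_le_mul _ _
        _ = L * ‖y + y‖ := by rw [dist_eq_norm]; congr 2; abel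
        _ ≤ L * (‖z‖ + ‖z‖) := by gcongr; exact (norm_add_le _ _).trans (by linarith)
        _ = _ := by ring
  rcases le_total 1 (‖z‖ ^ 2) with h | h
  · rw [min_eq_left h]; linarith [L.2]
  · rw [min_eq_right h]; nlinarith [sq_nonneg ‖z‖]

/-- The squared differences of a compactly supported `C¹` function are controlled by
`min 1 ‖x - y‖²`. -/
theorem exists_sq_sub_le {φ : E → ℝ} (hφ : ContDiff ℝ 1 φ) (hc : HasCompactSupport φ) :
    ∃ M : ℝ, 0 ≤ M ∧ ∀ x y, (φ x - φ y) ^ 2 ≤ M * min 1 (‖x - y‖ ^ 2) := by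
  obtain ⟨B, hB⟩ := hc.exists_bound_of_continuous hφ.continuous
  have hB0 : 0 ≤ B := (norm_nonneg _).trans (hB 0)
  obtain ⟨L, hL⟩ := ContDiff.lipschitzWith_of_hasCompactSupport (𝕂 := ℝ) hc hφ (by simp)
  refine ⟨4 * B ^ 2 + L ^ 2, by positivity, fun x y => ?_⟩
  have h1 : |φ x - φ y| ≤ 2 * B := by
    have a := abs_le.1 (hB x)
    have b := abs_le.1 (hB y)
    rw [abs_le]
    constructor <;> linarith [a.1, a.2, b.1, b.2]
  have h2 : |φ x - φ y| ≤ L * ‖x - y‖ := by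
    rw [← dist_eq_norm, ← Real.dist_eq]
    exact hL.dist_le_mul x y
  have h1' : (φ x - φ y) ^ 2 ≤ (2 * B) ^ 2 := by rw [← sq_abs]; gcongr
  have h2' : (φ x - φ y) ^ 2 ≤ (L * ‖x - y‖) ^ 2 := by rw [← sq_abs]; gcongr
  rcases le_total 1 (‖x - y‖ ^ 2) with h | h
  · rw [min_eq_left h]; nlinarith [sq_nonneg (L : ℝ)]
  · rw [min_eq_right h]; nlinarith [sq_nonneg ‖x - y‖, mul_nonneg (sq_nonneg B) (sq_nonneg ‖x - y‖)]

end Differences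

/-! ### Translates of a compact set: semicontinuity of averages and a Steinhaus argument. -/

section Translates

open Filter Topology Pointwise

theorem setLIntegral_comp_add_left {E : Type*} [NormedAddCommGroup E] [MeasurableSpace E] [BorelSpace E]
    {μ : Measure E} [μ.IsAddLeftInvariant] (f : E → ℝ≥0∞) (t : E) (A : Set E) :
    ∫⁻ z in A, f (t + z) ∂μ = ∫⁻ z in t +ᵥ A, f z ∂μ := by
  have := (measurePreserving_add_left μ t).setLIntegral_comp_emb
    (MeasurableEquiv.addLeft t).measurableEmbedding f A
  rw [this]; rfl

variable {E : Type*} [NormedAddCommGroup E] [NormedSpace ℝ E] [FiniteDimensional ℝ E]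
  [MeasurableSpace E] [BorelSpace E] {μ : Measure E} [μ.IsAddHaarMeasure]

/-- Translating by `-t` turns the set into `(-t +ᵥ A) \ A`, which shrinks into ever smaller
neighbourhoods of `A`. -/
theorem tendsto_measure_diff_vadd {A : Set E} (hA : IsCompact A) :
    Tendsto (fun t : E => μ (A \ (t +ᵥ A))) (𝓝 0) (𝓝 0) := by
  have h := (tendsto_measure_vadd_sdiff_isCompact_isClosed (G := E) (μ := μ) hA hA.isClosed).comp
    (continuous_neg.tendsto' (0 : E) 0 (by simp))
  refine h.congr fun t => ?_
  have : A \ (t +ᵥ A) = t +ᵥ ((-t +ᵥ A) \ A) := by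
    rw [vadd_set_sdiff, vadd_vadd]; simp
  rw [this, measure_vadd]; rfl

/-- Lower semicontinuity of `x ↦ ∫_A f(x+z) dz`, in quantitative form. -/
theorem exists_pos_le_setLIntegral_comp_add {A : Set E} (hA : IsCompact A) (hμA : MeasurableSet A)
    {f : E → ℝ≥0∞} {x₀ : E} (hfin : ∫⁻ z in A, f (x₀ + z) ∂μ ≠ ∞)
    (hpos : ∫⁻ z in A, f (x₀ + z) ∂μ ≠ 0) :
    ∃ m : ℝ≥0∞, m ≠ 0 ∧ m ≠ ∞ ∧ ∃ ρ : ℝ, 0 < ρ ∧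
      ∀ x ∈ Metric.ball x₀ ρ, m ≤ ∫⁻ z in A, f (x + z) ∂μ := by
  set I := ∫⁻ z in A, f (x₀ + z) ∂μ with hI
  have hmeas (t : E) : MeasurableSet (t +ᵥ A) := hμA.const_vadd t
  -- Moving the centre from `x₀` to `x₀ + t` loses only the integral over `A \ (t +ᵥ A)`, which is
  -- small by absolute continuity; `ρ` is chosen so that at most half is lost.
  have hlim : Tendsto (fun t : E => ∫⁻ z in A \ (t +ᵥ A), f (x₀ + z) ∂(μ.restrict A)) (𝓝 0) (𝓝 0) := by
    refine tendsto_setLIntegral_zero hfin ?_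
    refine tendsto_of_tendsto_of_tendsto_of_le_of_le tendsto_const_nhds
      (tendsto_measure_diff_vadd (μ := μ) hA) (fun _ => zero_le) fun t => ?_
    exact Measure.restrict_apply_le _ _
  have hI2 : 0 < I / 2 := ENNReal.half_pos hpos
  obtain ⟨ρ, hρ, hball⟩ := Metric.eventually_nhds_iff_ball.1 (hlim.eventually_lt_const hI2)
  refine ⟨I / 2, hI2.ne', ENNReal.div_ne_top hfin (by simp), ρ, hρ, fun x hx => ?_⟩
  have ht := hball (x - x₀) (by simpa [dist_eq_norm] using hx)
  rw [Measure.restrict_restrict (hμA.diff (hmeas _)), inter_eq_left.2 sdiff_subset] at ht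
  have e1 : ∫⁻ z in A, f (x + z) ∂μ = ∫⁻ z in (x - x₀) +ᵥ A, f (x₀ + z) ∂μ := by
    rw [← setLIntegral_comp_add_left (fun z => f (x₀ + z))]
    refine lintegral_congr fun z => ?_
    congr 1; abel
  have e2 : I = ∫⁻ z in A ∩ ((x - x₀) +ᵥ A), f (x₀ + z) ∂μ
      + ∫⁻ z in A \ ((x - x₀) +ᵥ A), f (x₀ + z) ∂μ :=
    (lintegral_inter_add_sdiff _ _ (hmeas _)).symm
  have e3 : ∫⁻ z in A ∩ ((x - x₀) +ᵥ A), f (x₀ + z) ∂μ ≤ ∫⁻ z in A, f (x + z) ∂μ := by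
    rw [e1]; exact lintegral_mono_set inter_subset_right
  have e4 : I / 2 + I / 2 ≤ ∫⁻ z in A, f (x + z) ∂μ + I / 2 := by
    rw [ENNReal.add_halves, e2]
    refine add_le_add e3 ?_
    rw [← e2]; exact ht.le
  exact (ENNReal.add_le_add_iff_right (ENNReal.div_ne_top hfin (by simp))).1 e4

/-- If the iterated averages of `f ≥ 0` over `x + A - A` vanish, then `f = 0` near `x`. -/
theorem exists_ball_ae_eq_zero {A : Set E} (hA : IsCompact A) (hμA : MeasurableSet A)
    (hApos : μ A ≠ 0) {f : E → ℝ≥0∞} (hf : AEMeasurable f μ) :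
    ∃ ρ : ℝ, 0 < ρ ∧ ∀ x, (∀ᵐ z ∂μ.restrict A, ∫⁻ z' in A, f (x + z - z') ∂μ = 0) →
      ∀ᵐ y ∂μ.restrict (Metric.ball x ρ), f y = 0 := by
  obtain ⟨ρ, hρ, hball⟩ := Metric.eventually_nhds_iff_ball.1
    ((tendsto_measure_diff_vadd (μ := μ) hA).eventually_lt_const (pos_iff_ne_zero.2 hApos))
  refine ⟨ρ, hρ, fun x hx => ?_⟩
  -- After the substitution `t = z - z'`, Tonelli rewrites this as the integral of `μ (A ∩ (t +ᵥ A))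
  -- * f (x + t)` over `t`; the overlap is positive for `‖t‖ < ρ`, forcing `f (x + t) = 0` there
  -- a.e.
  have h0 : ∫⁻ z, ∫⁻ t, A.indicator 1 z * A.indicator 1 (z - t) * f (x + t) ∂μ ∂μ = 0 := by
    rw [← lintegral_zero (μ := μ)]
    refine lintegral_congr_ae ?_
    filter_upwards [(ae_restrict_iff' hμA).1 hx] with z hz
    by_cases hzA : z ∈ A
    · have h1 := hz hzA
      rw [← lintegral_indicator hμA] at h1
      rw [← lintegral_sub_left_eq_self _ z] at h1
      rw [← h1]
      refine lintegral_congr fun t => ?_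
      by_cases ht : z - t ∈ A
      · simp [ht, hzA, show x + z - (z - t) = x + t by abel]
      · simp [ht]
    · simp [hzA]
  have hind : Measurable (A.indicator (1 : E → ℝ≥0∞)) := measurable_one.indicator hμA
  have hmeas : AEMeasurable (Function.uncurry fun z t : E =>
      A.indicator 1 z * A.indicator 1 (z - t) * f (x + t)) (μ.prod μ) := by
    have h2 : AEMeasurable (fun p : E × E => f (x + p.2)) (μ.prod μ) :=
      (hf.comp_quasiMeasurePreserving (quasiMeasurePreserving_add_left μ x)).comp_quasiMeasurePreserving
        Measure.quasiMeasurePreserving_snd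
    exact ((hind.comp measurable_fst).mul (hind.comp measurable_sub)).aemeasurable.mul h2
  rw [lintegral_lintegral_swap] at h0
  · rw [lintegral_eq_zero_iff'] at h0
    · have h1 : ∀ᵐ t ∂μ, t ∈ Metric.ball (0 : E) ρ → f (x + t) = 0 := by
        filter_upwards [h0] with t ht htb
        simp only [Pi.zero_apply] at ht
        rw [lintegral_mul_const _ (by fun_prop)] at ht
        rcases mul_eq_zero.1 ht with h | h
        · exfalso
          have : ∀ z, A.indicator (1 : E → ℝ≥0∞) z * A.indicator 1 (z - t)
              = (A ∩ (t +ᵥ A)).indicator 1 z := by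
            intro z
            have : z ∈ t +ᵥ A ↔ z - t ∈ A := by
              rw [mem_vadd_set_iff_neg_vadd_mem, vadd_eq_add, neg_add_eq_sub]
            by_cases h1 : z ∈ A <;> by_cases h2 : z - t ∈ A <;> simp [h1, h2, this]
          simp_rw [this] at h
          rw [lintegral_indicator_one (hμA.inter (hμA.const_vadd t))] at h
          have := measure_inter_add_sdiff (μ := μ) A (hμA.const_vadd t)
          rw [h, zero_add] at this
          exact (hball t htb).ne this
        · exact h
      rw [ae_restrict_iff' Metric.isOpen_ball.measurableSet]
      have h2 := (quasiMeasurePreserving_add_left μ (-x)).ae h1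
      filter_upwards [h2] with y hy hyb
      have := hy (by simpa [dist_eq_norm, neg_add_eq_sub] using hyb)
      simpa using this
    · exact hmeas.lintegral_prod_left'
  · exact hmeas

end Translates

/-! ### Mollification of `u` and its second differences. -/

section Mollification

open scoped Convolution
open ContinuousLinearMap (mul)

variable {E : Type*} [NormedAddCommGroup E] [MeasurableSpace E] {μ : Measure E} {u η : E → ℝ}

theorem convolution_mul_apply (x : E) :
    (u ⋆[mul ℝ ℝ, μ] η) x = ∫ y, u y * η (x - y) ∂μ := rfl

theorem convolution_mul_nonneg (hu : ∀ᵐ x ∂μ, 0 ≤ u x) (hη : ∀ x, 0 ≤ η x) (x : E) :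
    0 ≤ (u ⋆[mul ℝ ℝ, μ] η) x := by
  rw [convolution_mul_apply]
  refine integral_nonneg_of_ae ?_
  filter_upwards [hu] with y hy using mul_nonneg hy (hη _)

variable [BorelSpace E]

theorem continuous_convolution_mul (hu : LocallyIntegrable u μ) (hη : Continuous η)
    (hηc : HasCompactSupport η) : Continuous (u ⋆[mul ℝ ℝ, μ] η) :=
  hηc.continuous_convolution_right _ hu hη

theorem integrable_mul_comp_sub_left (hu : LocallyIntegrable u μ) (hη : Continuous η)
    (hηc : HasCompactSupport η) (x : E) : Integrable (fun y => u y * η (x - y)) μ := by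
  have := hu.integrable_smul_left_of_hasCompactSupport (g := fun y => η (x - y)) (by fun_prop)
    (hηc.comp_homeomorph (Homeomorph.subLeft x))
  simpa only [smul_eq_mul, mul_comm] using this

section

variable [μ.IsAddLeftInvariant]

theorem integral_translate_mul_comp_sub_left (x z : E) :
    ∫ y, u (z + y) * η (x - y) ∂μ = (u ⋆[mul ℝ ℝ, μ] η) (x + z) := by
  rw [convolution_mul_apply,
    ← integral_add_left_eq_self (fun y => u y * η (x + z - y)) z]
  refine integral_congr_ae (ae_of_all _ fun y => ?_)
  simp only [show x + z - (z + y) = x - y by abel]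

theorem integrable_translate_mul_comp_sub_left (hu : LocallyIntegrable u μ) (hη : Continuous η)
    (hηc : HasCompactSupport η) (x z : E) :
    Integrable (fun y => u (z + y) * η (x - y)) μ := by
  have := (integrable_mul_comp_sub_left hu hη hηc (x + z)).comp_add_left z
  refine this.congr (ae_of_all _ fun y => ?_)
  simp only
  congr 2
  abel

/-- The polarised difference integral against a reflected mollifier is a second difference of the
mollification. -/
theorem integral_diff_mul_diff_comp_sub_left (hu : LocallyIntegrable u μ) (hη : Continuous η)
    (hηc : HasCompactSupport η) (x z : E) :
    ∫ y, (u (z + y) - u y) * (η (x - (z + y)) - η (x - y)) ∂μ =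
      2 * (u ⋆[mul ℝ ℝ, μ] η) x - (u ⋆[mul ℝ ℝ, μ] η) (x - z) - (u ⋆[mul ℝ ℝ, μ] η) (x + z) := by
  have e (y : E) : x - z - y = x - (z + y) := by abel
  have i1 : Integrable (fun y => u (z + y) * η (x - (z + y))) μ := by
    simpa only [e] using integrable_translate_mul_comp_sub_left hu hη hηc (x - z) z
  have i2 := integrable_mul_comp_sub_left hu hη hηc x
  have i3 : Integrable (fun y => u y * η (x - (z + y))) μ := by
    simpa only [e] using integrable_mul_comp_sub_left hu hη hηc (x - z)
  have i4 := integrable_translate_mul_comp_sub_left hu hη hηc x z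
  have v1 : ∫ y, u (z + y) * η (x - (z + y)) ∂μ = (u ⋆[mul ℝ ℝ, μ] η) x := by
    simpa only [e, sub_add_cancel] using
      integral_translate_mul_comp_sub_left (u := u) (η := η) (μ := μ) (x - z) z
  have v3 : ∫ y, u y * η (x - (z + y)) ∂μ = (u ⋆[mul ℝ ℝ, μ] η) (x - z) := by
    simp only [convolution_mul_apply, e]
  have v4 := integral_translate_mul_comp_sub_left (u := u) (η := η) (μ := μ) x z
  calc _ = ∫ y, (u (z + y) * η (x - (z + y)) + u y * η (x - y)
        - u y * η (x - (z + y)) - u (z + y) * η (x - y)) ∂μ := by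
        congr 1; ext y; ring
    _ = _ := by
        have h12 := i1.add i2
        have h123 := h12.sub i3
        simp only [Pi.add_def, Pi.sub_def] at h12 h123
        rw [integral_sub h123 i4, integral_sub h12 i3, integral_add i1 i2,
          v1, v3, v4, ← convolution_mul_apply]
        ring

end

variable [NormedSpace ℝ E] [FiniteDimensional ℝ E] [μ.IsAddHaarMeasure]

/-- Lower bounds for the averages of `u` over `x + A` pass to the mollification. -/
theorem le_setIntegral_convolution (hu : LocallyIntegrable u μ) (hu0 : ∀ᵐ x ∂μ, 0 ≤ u x)
    (hη : Continuous η) (hηc : HasCompactSupport η) (hη0 : ∀ x, 0 ≤ η x) (hη1 : ∫ x, η x ∂μ = 1)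
    {A : Set E} (hA : IsCompact A) {m : ℝ≥0∞} {x : E}
    (hle : ∀ t, η t ≠ 0 → m ≤ ∫⁻ z in A, ENNReal.ofReal (u (x - t + z)) ∂μ) :
    m.toReal ≤ ∫ z in A, (u ⋆[mul ℝ ℝ, μ] η) (x + z) ∂μ := by
  have hcont := continuous_convolution_mul hu hη hηc
  have hnn := convolution_mul_nonneg hu0 hη0
  have hint : IntegrableOn (fun z => (u ⋆[mul ℝ ℝ, μ] η) (x + z)) A μ :=
    (by fun_prop : Continuous fun z => (u ⋆[mul ℝ ℝ, μ] η) (x + z)).continuousOn.integrableOn_compact hA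
  have hum : AEMeasurable u μ := hu.aestronglyMeasurable.aemeasurable
  rw [← ENNReal.toReal_ofReal (integral_nonneg fun z => hnn (x + z))]
  refine ENNReal.toReal_mono ENNReal.ofReal_ne_top ?_
  rw [ofReal_integral_eq_lintegral_ofReal hint (ae_of_all _ fun z => hnn (x + z))]
  have e1 (z : E) : ENNReal.ofReal ((u ⋆[mul ℝ ℝ, μ] η) (x + z)) =
      ∫⁻ t, ENNReal.ofReal (u (x - t + z)) * ENNReal.ofReal (η t) ∂μ := by
    rw [convolution_mul_apply, ofReal_integral_eq_lintegral_ofReal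
      (integrable_mul_comp_sub_left hu hη hηc _), ← lintegral_sub_left_eq_self _ (x + z)]
    · refine lintegral_congr fun t => ?_
      rw [sub_sub_cancel, ENNReal.ofReal_mul' (hη0 _), show x + z - t = x - t + z by abel]
    · filter_upwards [hu0] with y hy using mul_nonneg hy (hη0 _)
  simp_rw [e1]
  -- By Tonelli the integral of the mollification over `x + A` is the `η`-weighted mean over `t` of
  -- the integrals of `u` over `x - t + A`, and `η` has mass one.
  rw [lintegral_lintegral_swap]
  · calc m = ∫⁻ t, m * ENNReal.ofReal (η t) ∂μ := by
          rw [lintegral_const_mul _ (by fun_prop), ← ofReal_integral_eq_lintegral_ofReal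
            (hη.integrable_of_hasCompactSupport hηc) (ae_of_all _ hη0), hη1]
          simp
      _ ≤ _ := by
          refine lintegral_mono fun t => ?_
          by_cases ht : η t = 0
          · simp [ht]
          · have hmm : AEMeasurable (fun z => ENNReal.ofReal (u (x - t + z))) (μ.restrict A) :=
              ((hum.comp_quasiMeasurePreserving
                (quasiMeasurePreserving_add_left μ (x - t))).ennreal_ofReal).restrict
            rw [lintegral_mul_const'' _ hmm]
            gcongr
            exact hle t ht
  · have h1 : AEMeasurable (fun p : E × E => u (x - p.2 + p.1)) (μ.prod μ) := by
      have := ((hum.comp_quasiMeasurePreserving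
        (quasiMeasurePreserving_add_left μ x)).comp_quasiMeasurePreserving
        (quasiMeasurePreserving_sub μ μ))
      refine this.congr (ae_of_all _ fun p => ?_)
      simp only [Function.comp]
      congr 1; abel
    have h2 : AEMeasurable (fun p : E × E => ENNReal.ofReal (η p.2)) (μ.prod μ) := by fun_prop
    have h3 := h1.ennreal_ofReal.mul h2
    exact h3.mono_ac (Measure.restrict_le_self.absolutelyContinuous.prod .rfl)

end Mollification

/-! ### From the weak inequality to a pointwise inequality for the mollification. -/

section Energy

open scoped Convolution
open ContinuousLinearMap (mul)

variable {N : ℕ} {j : EuclideanSpace ℝ (Fin N) → ℝ≥0∞} {Ω : Set (EuclideanSpace ℝ (Fin N))}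
  {u c φ η : EuclideanSpace ℝ (Fin N) → ℝ}

theorem MemLpLocOn.locallyIntegrable (hu : MemLpLocOn u 2 univ) : LocallyIntegrable u := by
  rw [locallyIntegrable_iff]
  intro K hK
  have : IsFiniteMeasure (volume.restrict K) := ⟨by simpa using hK.measure_lt_top⟩
  exact (hu K hK (subset_univ _)).integrable (by norm_num)

theorem LevyKernel.aemeasurable_comp_sub (hj : LevyKernel j) :
    AEMeasurable (fun p : EuclideanSpace ℝ (Fin N) × EuclideanSpace ℝ (Fin N) => j (p.1 - p.2)) :=
  hj.aemeasurable.comp_quasiMeasurePreserving (quasiMeasurePreserving_sub volume volume)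

/-- The product of differences is at most the sum of their squares and vanishes unless one variable
lies in `tsupport φ`. For the first variable there, the `u` part is finite by `MemVLoc` and the `φ`
part by the Lévy condition; evenness of `j` covers the other variable. -/
theorem MemVLoc.integrable_energy (hj : LevyKernel j) (hu : MemVLoc j Ω u) (hφ : ContDiff ℝ 1 φ)
    (hφc : HasCompactSupport φ) (hφΩ : tsupport φ ⊆ Ω) :
    Integrable (fun p : EuclideanSpace ℝ (Fin N) × EuclideanSpace ℝ (Fin N) =>
      (u p.1 - u p.2) * (φ p.1 - φ p.2) * (j (p.1 - p.2)).toReal) := by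
  have hum : AEMeasurable u := hu.1.locallyIntegrable.aestronglyMeasurable.aemeasurable
  have hum1 : AEMeasurable (fun p : EuclideanSpace ℝ (Fin N) × EuclideanSpace ℝ (Fin N) => u p.1) :=
    hum.comp_quasiMeasurePreserving Measure.quasiMeasurePreserving_fst
  have hum2 : AEMeasurable (fun p : EuclideanSpace ℝ (Fin N) × EuclideanSpace ℝ (Fin N) => u p.2) :=
    hum.comp_quasiMeasurePreserving Measure.quasiMeasurePreserving_snd
  have hφm : Measurable φ := hφ.continuous.measurable
  have hjm := hj.aemeasurable_comp_sub
  refine ⟨(((hum1.sub hum2).mul (by fun_prop)).mul hjm.ennreal_toReal).aestronglyMeasurable, ?_⟩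
  obtain ⟨M, hM0, hM⟩ := exists_sq_sub_le hφ hφc
  set K := tsupport φ with hK
  have hKm : MeasurableSet K := (isClosed_tsupport φ).measurableSet
  set G : EuclideanSpace ℝ (Fin N) × EuclideanSpace ℝ (Fin N) → ℝ≥0∞ := fun p =>
    (ENNReal.ofReal ((u p.1 - u p.2) ^ 2) + ENNReal.ofReal ((φ p.1 - φ p.2) ^ 2)) * j (p.1 - p.2)
    with hG
  have hGm : AEMeasurable G :=
    (((hum1.sub hum2).pow_const 2).ennreal_ofReal.add (by fun_prop)).mul hjm
  have hKi : Measurable (fun p : EuclideanSpace ℝ (Fin N) × EuclideanSpace ℝ (Fin N) =>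
      K.indicator (1 : EuclideanSpace ℝ (Fin N) → ℝ≥0∞) p.1) :=
    (measurable_one.indicator hKm).comp measurable_fst
  have hKGm : AEMeasurable (fun p =>
      K.indicator (1 : EuclideanSpace ℝ (Fin N) → ℝ≥0∞) p.1 * G p) := hKi.aemeasurable.mul hGm
  have hfin : ∫⁻ p, K.indicator (1 : EuclideanSpace ℝ (Fin N) → ℝ≥0∞) p.1 * G p < ∞ := by
    rw [Measure.volume_eq_prod] at hKGm hGm hjm hum1 hum2 ⊢
    rw [lintegral_prod _ hKGm]
    have e1 : ∀ x, ∫⁻ y, K.indicator (1 : EuclideanSpace ℝ (Fin N) → ℝ≥0∞) x * G (x, y) =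
        K.indicator (fun x => ∫⁻ y, G (x, y)) x := by
      intro x
      by_cases hx : x ∈ K <;> simp [hx]
    simp only [e1]
    rw [lintegral_indicator hKm]
    have e2 : ∀ x, ∫⁻ y, G (x, y) ≤ (∫⁻ y, ENNReal.ofReal ((u x - u y) ^ 2) * j (x - y)) +
        ENNReal.ofReal M * ∫⁻ z, ENNReal.ofReal (min 1 (‖z‖ ^ 2)) * j z := by
      intro x
      have hx : AEMeasurable (fun y => ENNReal.ofReal ((φ x - φ y) ^ 2) * j (x - y)) :=
        (by fun_prop : Measurable fun y => ENNReal.ofReal ((φ x - φ y) ^ 2)).aemeasurable.mul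
          (hj.aemeasurable.comp_quasiMeasurePreserving (quasiMeasurePreserving_sub_left volume x))
      simp only [hG, add_mul]
      rw [lintegral_add_right' _ hx]
      gcongr
      rw [← lintegral_const_mul' _ _ ENNReal.ofReal_ne_top,
        ← lintegral_sub_left_eq_self _ x]
      refine lintegral_mono fun y => ?_
      rw [← mul_assoc, ← ENNReal.ofReal_mul hM0]
      gcongr
      · simpa using hM x (x - y)
      · simp
    calc _ ≤ ∫⁻ x in K, ((∫⁻ y, ENNReal.ofReal ((u x - u y) ^ 2) * j (x - y)) +
        ENNReal.ofReal M * ∫⁻ z, ENNReal.ofReal (min 1 (‖z‖ ^ 2)) * j z) :=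
          lintegral_mono e2
      _ = (∫⁻ x in K, ∫⁻ y, ENNReal.ofReal ((u x - u y) ^ 2) * j (x - y)) +
        ENNReal.ofReal M * (∫⁻ z, ENNReal.ofReal (min 1 (‖z‖ ^ 2)) * j z) * volume K := by
          rw [lintegral_add_right _ measurable_const]; simp
      _ < ∞ := by
          refine ENNReal.add_lt_top.2 ⟨?_, ?_⟩
          · exact hu.2 K hKm (by rwa [(isClosed_tsupport φ).closure_eq])
              (by rwa [(isClosed_tsupport φ).closure_eq])
          · exact ENNReal.mul_lt_top (ENNReal.mul_lt_top ENNReal.ofReal_lt_top hj.lintegral_lt_top)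
              hφc.isCompact.measure_lt_top
  have hswap : ∫⁻ p, K.indicator (1 : EuclideanSpace ℝ (Fin N) → ℝ≥0∞) p.2 * G p =
      ∫⁻ p, K.indicator (1 : EuclideanSpace ℝ (Fin N) → ℝ≥0∞) p.1 * G p := by
    rw [Measure.volume_eq_prod, ← lintegral_prod_swap]
    refine lintegral_congr fun p => ?_
    have : G p.swap = G p := by
      simp only [hG, Prod.fst_swap, Prod.snd_swap]
      rw [← hj.even (p.1 - p.2), neg_sub, sub_sq_comm, sub_sq_comm (φ p.2)]
    rw [this]; rfl
  calc _ ≤ ∫⁻ p, (K.indicator (1 : EuclideanSpace ℝ (Fin N) → ℝ≥0∞) p.1 * G p +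
        K.indicator (1 : EuclideanSpace ℝ (Fin N) → ℝ≥0∞) p.2 * G p) := by
        refine lintegral_mono fun p => ?_
        by_cases hp : p.1 ∈ K ∨ p.2 ∈ K
        · have h1 : ‖(u p.1 - u p.2) * (φ p.1 - φ p.2) * (j (p.1 - p.2)).toReal‖ₑ ≤ G p := by
            rw [enorm_mul]
            refine mul_le_mul' ?_ ?_
            · rw [← ENNReal.ofReal_add (sq_nonneg _) (sq_nonneg _), ← ofReal_norm]
              refine ENNReal.ofReal_le_ofReal ?_
              rw [Real.norm_eq_abs, abs_le]
              constructor <;> nlinarith [sq_nonneg (u p.1 - u p.2 + (φ p.1 - φ p.2)),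
                sq_nonneg (u p.1 - u p.2 - (φ p.1 - φ p.2)), sq_nonneg (u p.1 - u p.2),
                sq_nonneg (φ p.1 - φ p.2)]
            · rw [Real.enorm_of_nonneg ENNReal.toReal_nonneg]
              exact ENNReal.ofReal_toReal_le
          refine h1.trans ?_
          rcases hp with h | h <;> simp [h]
        · push Not at hp
          beta_reduce
          rw [image_eq_zero_of_notMem_tsupport hp.1, image_eq_zero_of_notMem_tsupport hp.2]
          simp
    _ = _ := by rw [lintegral_add_left' hKGm, hswap]
    _ < ∞ := ENNReal.add_lt_top.2 ⟨hfin, hfin⟩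

/-- The energy of `u` against a reflected mollifier is the pointwise nonlocal operator applied to the
mollification of `u`. -/
theorem energyForm_comp_sub_left (hu : LocallyIntegrable u) (hη : Continuous η)
    (hηc : HasCompactSupport η) (x : EuclideanSpace ℝ (Fin N))
    (hint : Integrable (fun p : EuclideanSpace ℝ (Fin N) × EuclideanSpace ℝ (Fin N) =>
      (u p.1 - u p.2) * (η (x - p.1) - η (x - p.2)) * (j (p.1 - p.2)).toReal)) :
    Integrable (fun z => (2 * (u ⋆[mul ℝ ℝ] η) x - (u ⋆[mul ℝ ℝ] η) (x - z) -
      (u ⋆[mul ℝ ℝ] η) (x + z)) * (j z).toReal) ∧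
    energyForm j u (fun y => η (x - y)) = 1 / 2 *
      ∫ z, (2 * (u ⋆[mul ℝ ℝ] η) x - (u ⋆[mul ℝ ℝ] η) (x - z) - (u ⋆[mul ℝ ℝ] η) (x + z)) *
        (j z).toReal := by
  -- The shear `(z, y) ↦ (z + y, y)` makes the kernel depend on `z` alone, so Fubini can integrate
  -- in `y` first.
  have hT := measurePreserving_add_prod (volume : Measure (EuclideanSpace ℝ (Fin N)))
    (volume : Measure (EuclideanSpace ℝ (Fin N)))
  set F : EuclideanSpace ℝ (Fin N) × EuclideanSpace ℝ (Fin N) → ℝ := fun p =>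
    (u p.1 - u p.2) * (η (x - p.1) - η (x - p.2)) * (j (p.1 - p.2)).toReal with hF
  rw [Measure.volume_eq_prod] at hint
  have hFT : Integrable (fun p : EuclideanSpace ℝ (Fin N) × EuclideanSpace ℝ (Fin N) =>
      (u (p.1 + p.2) - u p.2) * (η (x - (p.1 + p.2)) - η (x - p.2)) * (j p.1).toReal)
      (volume.prod volume) := by
    refine (hT.integrable_comp_of_integrable hint).congr (ae_of_all _ fun p => ?_)
    simp [hF]
  have hval : ∫ p, F p ∂(volume.prod volume) =
      ∫ p : EuclideanSpace ℝ (Fin N) × EuclideanSpace ℝ (Fin N),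
      (u (p.1 + p.2) - u p.2) * (η (x - (p.1 + p.2)) - η (x - p.2)) * (j p.1).toReal
      ∂(volume.prod volume) := by
    conv_lhs => rw [← hT.map_eq]
    rw [integral_map hT.aemeasurable (by rw [hT.map_eq]; exact hint.aestronglyMeasurable)]
    simp [hF]
  have hinner (z : EuclideanSpace ℝ (Fin N)) :
      ∫ y, (u (z + y) - u y) * (η (x - (z + y)) - η (x - y)) * (j z).toReal =
        (2 * (u ⋆[mul ℝ ℝ] η) x - (u ⋆[mul ℝ ℝ] η) (x - z) - (u ⋆[mul ℝ ℝ] η) (x + z)) *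
          (j z).toReal := by
    rw [integral_mul_const, integral_diff_mul_diff_comp_sub_left hu hη hηc]
  refine ⟨?_, ?_⟩
  · simpa only [hinner] using hFT.integral_prod_left
  · rw [energyForm, Measure.volume_eq_prod]
    congr 1
    calc _ = _ := hval
      _ = _ := integral_prod _ hFT
      _ = _ := by simp only [hinner]

/-- The test function is `y ↦ η (x - y)`; its support lies in `K`, so only the bound `-C ≤ c` on `K`
matters. -/
theorem IsWeakSupersolution.secondDiff_convolution (hj : LevyKernel j)
    (hu : IsWeakSupersolution j c Ω u) (hu0 : ∀ᵐ x, 0 ≤ u x)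
    {K : Set (EuclideanSpace ℝ (Fin N))} (hK : IsCompact K) (hKΩ : K ⊆ Ω) {C : ℝ}
    (hC0 : 0 ≤ C) (hC : ∀ᵐ x ∂volume.restrict K, -C ≤ c x) (hη : ContDiff ℝ (⊤ : ℕ∞) η)
    (hηc : HasCompactSupport η) (hη0 : ∀ y, 0 ≤ η y) {x : EuclideanSpace ℝ (Fin N)}
    (hηK : ∀ y, η (x - y) ≠ 0 → y ∈ K) :
    Integrable (fun z => (2 * (u ⋆[mul ℝ ℝ] η) x - (u ⋆[mul ℝ ℝ] η) (x - z) -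
      (u ⋆[mul ℝ ℝ] η) (x + z)) * (j z).toReal) ∧
    -C * (u ⋆[mul ℝ ℝ] η) x ≤ 1 / 2 *
      ∫ z, (2 * (u ⋆[mul ℝ ℝ] η) x - (u ⋆[mul ℝ ℝ] η) (x - z) - (u ⋆[mul ℝ ℝ] η) (x + z)) *
        (j z).toReal := by
  set φ : EuclideanSpace ℝ (Fin N) → ℝ := fun y => η (x - y) with hφ
  have hφs : ContDiff ℝ (⊤ : ℕ∞) φ := hη.comp (contDiff_const.sub contDiff_id)
  have hφc : HasCompactSupport φ := hηc.comp_homeomorph (Homeomorph.subLeft x)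
  have hφK : tsupport φ ⊆ K := closure_minimal (fun y hy => hηK y hy) hK.isClosed
  have hul := hu.1.1.locallyIntegrable
  obtain ⟨h1, h2⟩ := energyForm_comp_sub_left (j := j) hul hη.continuous hηc x
    (hu.1.integrable_energy hj (hφs.of_le (by simp)) hφc (hφK.trans hKΩ))
  refine ⟨h1, ?_⟩
  rw [← h2]
  refine le_trans ?_ (hu.2 φ hφs hφc (hφK.trans hKΩ) fun y => hη0 _)
  have hi : Integrable (fun y => u y * φ y) :=
    integrable_mul_comp_sub_left hul hη.continuous hηc x
  have hmono : ∫ y in Ω, -C * (u y * φ y) ≤ ∫ y in Ω, c y * u y * φ y := by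
    by_cases hci : Integrable (fun y => c y * u y * φ y) (volume.restrict Ω)
    · refine integral_mono_ae (hi.const_mul _).restrict hci (ae_restrict_of_ae ?_)
      filter_upwards [(ae_restrict_iff' hK.measurableSet).1 hC, hu0] with y hy huy
      by_cases hyK : y ∈ K
      · have := mul_nonneg huy (hη0 (x - y))
        rw [mul_assoc]
        exact mul_le_mul_of_nonneg_right (hy hyK) this
      · have : φ y = 0 := image_eq_zero_of_notMem_tsupport fun h => hyK (hφK h)
        simp [this]
    -- A non-integrable right-hand side has integral `0` by convention, which still dominates the
    -- nonpositive left-hand side.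
    · rw [integral_undef hci, integral_const_mul]
      have : 0 ≤ ∫ y in Ω, u y * φ y := by
        refine integral_nonneg_of_ae (ae_restrict_of_ae ?_)
        filter_upwards [hu0] with y hy using mul_nonneg hy (hη0 _)
      nlinarith
  refine le_trans (le_of_eq ?_) hmono
  rw [integral_const_mul, convolution_mul_apply]
  congr 1
  refine (setIntegral_eq_integral_of_forall_compl_eq_zero fun y hy => ?_).symm
  have : φ y = 0 := image_eq_zero_of_notMem_tsupport fun h => hy (hKΩ (hφK h))
  exact mul_eq_zero_of_right _ this

end Energy

/-! ### The barrier argument. -/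

section Positivity

open scoped Convolution
open Filter Topology
open ContinuousLinearMap (mul)

variable {N : ℕ} {j : EuclideanSpace ℝ (Fin N) → ℝ≥0∞} {Ω : Set (EuclideanSpace ℝ (Fin N))}
  {u c : EuclideanSpace ℝ (Fin N) → ℝ}

theorem LevyKernel.integrable_min_mul_toReal (hj : LevyKernel j) :
    Integrable (fun z => min 1 (‖z‖ ^ 2) * (j z).toReal) := by
  have hm : AEMeasurable (fun z => min 1 (‖z‖ ^ 2) * (j z).toReal) :=
    (by fun_prop : Measurable fun z : EuclideanSpace ℝ (Fin N) =>
      min 1 (‖z‖ ^ 2)).aemeasurable.mul hj.aemeasurable.ennreal_toReal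
  refine ⟨hm.aestronglyMeasurable, lt_of_le_of_lt (lintegral_mono fun z => ?_) hj.lintegral_lt_top⟩
  rw [enorm_mul, Real.enorm_of_nonneg (by positivity), Real.enorm_of_nonneg ENNReal.toReal_nonneg]
  gcongr
  exact ENNReal.ofReal_toReal_le

theorem MemLpLocOn.exists_forall_abs_le (hc : MemLpLocOn c ∞ Ω)
    {K : Set (EuclideanSpace ℝ (Fin N))} (hK : IsCompact K) (hKΩ : K ⊆ Ω) :
    ∃ C : ℝ, 0 ≤ C ∧ ∀ᵐ x ∂volume.restrict K, |c x| ≤ C := by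
  have h := hc K hK hKΩ
  refine ⟨(eLpNorm c ∞ (volume.restrict K)).toReal, ENNReal.toReal_nonneg, ?_⟩
  have := enorm_ae_le_eLpNormEssSup c (volume.restrict K)
  filter_upwards [this] with x hx
  rw [← Real.norm_eq_abs, ← toReal_enorm]
  rw [← eLpNorm_exponent_top] at hx
  exact ENNReal.toReal_mono h.2.ne hx

/-- A nonnegative supersolution is essentially bounded below near every point of `Ω` at which the
average of `u` over a set where the kernel is bounded and bounded below is positive. -/
theorem IsWeakSupersolution.exists_pos_le_near (hj : LevyKernel j) (hΩ : IsOpen Ω)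
    (hc : MemLpLocOn c ∞ Ω) (hu : IsWeakSupersolution j c Ω u) (hu0 : ∀ᵐ x, 0 ≤ u x)
    {A : Set (EuclideanSpace ℝ (Fin N))} (hA : IsCompact A) {a b : ℝ} (ha : 0 < a)
    (hab : ∀ z ∈ A, a ≤ (j z).toReal ∧ (j z).toReal ≤ b) {x₀ : EuclideanSpace ℝ (Fin N)}
    (hx₀ : x₀ ∈ Ω) (hpos : ∫⁻ z in A, ENNReal.ofReal (u (x₀ + z)) ≠ 0) :
    ∃ ρ : ℝ, 0 < ρ ∧ ∃ δ : ℝ, 0 < δ ∧ ∀ᵐ y ∂volume.restrict (Metric.ball x₀ ρ), δ ≤ u y := by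
  have hul := hu.1.1.locallyIntegrable
  have hfin : ∫⁻ z in A, ENNReal.ofReal (u (x₀ + z)) ≠ ∞ := by
    rw [setLIntegral_comp_add_left (fun z => ENNReal.ofReal (u z))]
    exact (hul.integrableOn_isCompact (hA.vadd x₀)).lintegral_lt_top.ne
  obtain ⟨m, hm0, hmt, ρ₀, hρ₀, hball⟩ := exists_pos_le_setLIntegral_comp_add hA hA.measurableSet
    (f := fun z => ENNReal.ofReal (u z)) hfin hpos
  have hmpos : 0 < m.toReal := ENNReal.toReal_pos hm0 hmt
  obtain ⟨ε, hε, hεΩ⟩ := Metric.isOpen_iff.1 hΩ x₀ hx₀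
  -- The barrier lives within `2 * R` of `x₀` and the mollifiers have radius at most `R`, so
  -- everything stays within `3 * R`, inside both `Ω` and the ball where the averages are at least
  -- `m`.
  set R : ℝ := min ρ₀ ε / 4 with hR
  have hmin : 0 < min ρ₀ ε := lt_min hρ₀ hε
  have hR0 : 0 < R := by positivity
  have hRρ : 4 * R ≤ ρ₀ := by rw [hR]; linarith [min_le_left ρ₀ ε]
  have hRε : 4 * R ≤ ε := by rw [hR]; linarith [min_le_right ρ₀ ε]
  have hKΩ : Metric.closedBall x₀ (3 * R) ⊆ Ω :=
    (Metric.closedBall_subset_ball (by linarith)).trans hεΩ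
  obtain ⟨C, hC0, hC⟩ := hc.exists_forall_abs_le (isCompact_closedBall _ _) hKΩ
  let ψ : ContDiffBump x₀ := ⟨R, 2 * R, hR0, by linarith⟩
  obtain ⟨M, hM0, hM⟩ := exists_abs_secondDiff_le (ψ.contDiff (n := 2)) ψ.hasCompactSupport
  have hJi := hj.integrable_min_mul_toReal
  set J : ℝ := ∫ z, min 1 (‖z‖ ^ 2) * (j z).toReal with hJ
  have hJ0 : 0 ≤ J := integral_nonneg fun z => by positivity
  have hb : 0 ≤ b := by
    by_contra! hb
    have : A = ∅ := eq_empty_of_forall_notMem fun z hz => by linarith [(hab z hz).1, (hab z hz).2]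
    simp [this] at hpos
  -- `δ * D` collects the barrier's second differences, the term `2 * U x₁ * j` on `A`, and the
  -- zeroth-order term doubled by the factor `1 / 2`. Dividing by `D + 1` below makes `δ * D < a *
  -- m.toReal` strict even if `D = 0`.
  set D : ℝ := M * J + 2 * b * volume.real A + 2 * C with hD
  have hD0 : 0 ≤ D := by positivity
  set δ : ℝ := a * m.toReal / (D + 1) with hδ
  have hδ0 : 0 < δ := by positivity
  have hδD : δ * D < a * m.toReal := by
    have : δ * (D + 1) = a * m.toReal := by rw [hδ]; field_simp
    linarith
  -- Comparison of the mollified supersolution with the barrier `δ ψ`.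
  have hcomp : ∀ η : EuclideanSpace ℝ (Fin N) → ℝ, ContDiff ℝ (⊤ : ℕ∞) η → HasCompactSupport η →
      (∀ y, 0 ≤ η y) → ∫ y, η y = 1 → (∀ t, η t ≠ 0 → ‖t‖ ≤ R) →
      ∀ x, δ * ψ x ≤ (u ⋆[mul ℝ ℝ] η) x := by
    intro η hη hηc hη0 hη1 hηR
    set U := u ⋆[mul ℝ ℝ] η with hU
    have hUc : Continuous U := continuous_convolution_mul hul hη.continuous hηc
    have hU0 : ∀ x, 0 ≤ U x := convolution_mul_nonneg hu0 hη0
    by_contra! hex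
    obtain ⟨x, hx⟩ := hex
    have hψout : ∀ y, y ∉ Metric.closedBall x₀ (2 * R) → ψ y = 0 := fun y hy =>
      ψ.zero_of_le_dist (by simpa using (not_le.1 hy).le)
    obtain ⟨x₁, hx₁, hmin₁⟩ := (isCompact_closedBall x₀ (2 * R)).exists_isMinOn
      ⟨x₀, Metric.mem_closedBall_self (by positivity)⟩
      (hUc.sub (continuous_const.mul ψ.continuous) : Continuous fun y => U y - δ * ψ y).continuousOn
    have hxb : x ∈ Metric.closedBall x₀ (2 * R) := by
      by_contra h
      rw [hψout x h] at hx
      linarith [hU0 x]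
    have hneg : U x₁ - δ * ψ x₁ < 0 := by
      have : U x₁ - δ * ψ x₁ ≤ U x - δ * ψ x := hmin₁ hxb
      linarith
    -- The operator is nonlocal, so the minimum must be global; outside the ball `U - δψ = U ≥ 0`.
    have hglob : ∀ y, U x₁ - δ * ψ x₁ ≤ U y - δ * ψ y := by
      intro y
      by_cases hy : y ∈ Metric.closedBall x₀ (2 * R)
      · exact hmin₁ hy
      · rw [hψout y hy]; linarith [hU0 y]
    have hUδ : U x₁ ≤ δ := by
      have := ψ.le_one (x := x₁)
      nlinarith
    obtain ⟨hi, hsup⟩ := hu.secondDiff_convolution hj hu0 (isCompact_closedBall _ _) hKΩ hC0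
      (hC.mono fun y hy => (abs_le.1 hy).1) hη hηc hη0 (x := x₁) (fun y hy => by
        have h1 := hηR _ hy
        rw [Metric.mem_closedBall] at hx₁ ⊢
        rw [← dist_eq_norm] at h1
        linarith [dist_triangle_left y x₀ x₁])
    have hAU : m.toReal ≤ ∫ z in A, U (x₁ + z) := by
      refine le_setIntegral_convolution hul hu0 hη.continuous hηc hη0 hη1 hA fun t ht => hball _ ?_
      have h1 := hηR _ ht
      rw [Metric.mem_closedBall, dist_eq_norm] at hx₁
      rw [Metric.mem_ball, dist_eq_norm, sub_right_comm]
      linarith [norm_sub_le (x₁ - x₀) t]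
    have hUA : IntegrableOn (fun z => U (x₁ + z)) A :=
      (by fun_prop : Continuous fun z => U (x₁ + z)).continuousOn.integrableOn_compact hA
    have hconst : IntegrableOn (fun _ : EuclideanSpace ℝ (Fin N) => 2 * δ * b) A :=
      integrableOn_const hA.measure_lt_top.ne
    have hUA' : IntegrableOn (fun z => 2 * δ * b - a * U (x₁ + z)) A :=
      hconst.sub (hUA.const_mul a)
    -- Off `A`, minimality at `x₁` bounds the second difference of `U` by that of `δψ`. On `A`,
    -- which need not be symmetric, `U (x₁ - z) ≥ 0` is dropped, `U x₁ ≤ δ` is used, and `U (x₁ +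
    -- z)` is kept with weight `a`.
    have hle : ∫ z, (2 * U x₁ - U (x₁ - z) - U (x₁ + z)) * (j z).toReal ≤
        ∫ z, (δ * M * (min 1 (‖z‖ ^ 2) * (j z).toReal) +
          A.indicator (fun z => 2 * δ * b - a * U (x₁ + z)) z) := by
      refine integral_mono hi ((hJi.const_mul _).add
        (hUA'.integrable_indicator hA.measurableSet)) fun z => ?_
      have hk : 0 ≤ (j z).toReal := ENNReal.toReal_nonneg
      by_cases hz : z ∈ A
      · obtain ⟨hz1, hz2⟩ := hab z hz
        simp only [indicator_of_mem hz]
        have h1 : 0 ≤ δ * M * (min 1 (‖z‖ ^ 2) * (j z).toReal) := by positivity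
        have h2 : (2 * U x₁ - U (x₁ - z) - U (x₁ + z)) * (j z).toReal ≤
            (2 * δ - U (x₁ + z)) * (j z).toReal :=
          mul_le_mul_of_nonneg_right (by linarith [hU0 (x₁ - z)]) hk
        have h3 : δ * (j z).toReal ≤ δ * b := by gcongr
        have h4 : a * U (x₁ + z) ≤ (j z).toReal * U (x₁ + z) :=
          mul_le_mul_of_nonneg_right hz1 (hU0 _)
        linarith
      · simp only [indicator_of_notMem hz, add_zero]
        rw [← mul_assoc]
        refine mul_le_mul_of_nonneg_right ?_ hk
        have h1 := hglob (x₁ - z)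
        have h2 := hglob (x₁ + z)
        have h3 := mul_le_mul_of_nonneg_left ((le_abs_self _).trans (hM x₁ z)) hδ0.le
        linarith
    have hval : ∫ z, (δ * M * (min 1 (‖z‖ ^ 2) * (j z).toReal) +
          A.indicator (fun z => 2 * δ * b - a * U (x₁ + z)) z) =
        δ * M * J + (2 * δ * b * volume.real A - a * ∫ z in A, U (x₁ + z)) := by
      rw [integral_add (hJi.const_mul _) (hUA'.integrable_indicator hA.measurableSet),
        integral_const_mul, integral_indicator hA.measurableSet,
        integral_sub hconst.integrable (hUA.const_mul a),
        setIntegral_const, integral_const_mul, smul_eq_mul]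
      ring
    rw [hval] at hle
    have h1 : C * U x₁ ≤ C * δ := by gcongr
    have h2 : a * m.toReal ≤ a * ∫ z in A, U (x₁ + z) := by gcongr
    rw [hD] at hδD
    linarith
  refine ⟨R, hR0, δ, hδ0, ?_⟩
  -- The fixed ratio `2` of outer to inner radius is what a.e. convergence of the mollifications of
  -- a merely locally integrable `u` requires.
  let η : ℕ → ContDiffBump (0 : EuclideanSpace ℝ (Fin N)) := fun n =>
    ⟨R / (2 * (n + 1)), R / (n + 1), by positivity, by
      gcongr; linarith [(n.cast_nonneg : (0 : ℝ) ≤ n)]⟩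
  have hlim := ContDiffBump.ae_convolution_tendsto_right_of_locallyIntegrable (μ := volume)
    (φ := η) (l := atTop) (K := 2) ?_ ?_ hul
  · rw [ae_restrict_iff' Metric.isOpen_ball.measurableSet]
    filter_upwards [hlim] with y hy hyb
    refine ge_of_tendsto hy (Eventually.of_forall fun n => ?_)
    have h1 := hcomp ((η n).normed volume) (η n).contDiff_normed (η n).hasCompactSupport_normed
      (η n).nonneg_normed (η n).integral_normed (fun t ht => ?_) y
    · rw [ψ.one_of_mem_closedBall (Metric.ball_subset_closedBall hyb), mul_one] at h1
      refine h1.trans_eq ?_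
      rw [convolution_mul_apply, convolution_lsmul_swap]
      simp only [smul_eq_mul, mul_comm]
    · have h2 : t ∈ Function.support ((η n).normed volume) := ht
      rw [ContDiffBump.support_normed_eq, mem_ball_zero_iff] at h2
      refine h2.le.trans ?_
      exact div_le_self hR0.le (by linarith [(n.cast_nonneg : (0 : ℝ) ≤ n)])
  · have := tendsto_one_div_add_atTop_nhds_zero_nat.const_mul R
    simpa [η, div_eq_mul_inv] using this
  · refine Eventually.of_forall fun n => le_of_eq ?_
    simp only [η]
    field_simp

end Positivity

/-! ### The local dichotomy and the conclusion by connectedness. -/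

section StrongMaximumPrinciple

open Filter Topology Pointwise

variable {N : ℕ} {j : EuclideanSpace ℝ (Fin N) → ℝ≥0∞} {Ω : Set (EuclideanSpace ℝ (Fin N))}
  {u c : EuclideanSpace ℝ (Fin N) → ℝ}

/-- The weight `min 1 (‖z‖ ^ 2)` vanishes only at the origin, which is a null set once `N ≠ 0`. -/
theorem LevyKernel.ae_ne_top [NeZero N] (hj : LevyKernel j) : ∀ᵐ z, j z ≠ ∞ := by
  have h1 := ae_lt_top' ((by fun_prop : Measurable fun z : EuclideanSpace ℝ (Fin N) =>
      ENNReal.ofReal (min 1 (‖z‖ ^ 2))).aemeasurable.mul hj.aemeasurable) hj.lintegral_lt_top.ne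
  have h2 : ∀ᵐ z : EuclideanSpace ℝ (Fin N), z ≠ 0 := by
    simp [ae_iff]
  filter_upwards [h1, h2] with z hz hz0 h
  simp only [Pi.mul_apply, h] at hz
  rw [ENNReal.mul_top] at hz
  · exact hz.ne rfl
  · have := norm_pos_iff.2 hz0
    exact (ENNReal.ofReal_pos.2 (by positivity)).ne'

/-- Near the origin the kernel is bounded and bounded below on a compact set of positive measure. -/
theorem LevyKernel.exists_isCompact_bounds [NeZero N] (hj : LevyKernel j)
    (hj' : NontrivialNearZero j) {r : ℝ} (hr : 0 < r) :
    ∃ A : Set (EuclideanSpace ℝ (Fin N)), IsCompact A ∧ A ⊆ Metric.ball 0 r ∧ volume A ≠ 0 ∧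
      ∃ a b : ℝ, 0 < a ∧ ∀ z ∈ A, a ≤ (j z).toReal ∧ (j z).toReal ≤ b := by
  -- These sets exhaust the part of the ball where `0 < j < ∞`, so one has positive measure; inner
  -- regularity then yields a compact subset.
  let S : ℕ → Set (EuclideanSpace ℝ (Fin N)) := fun n =>
    Metric.ball 0 r ∩ (fun z => (j z).toReal) ⁻¹' Icc (1 / ((n : ℝ) + 1)) (n + 1)
  have hS (n : ℕ) : NullMeasurableSet (S n) :=
    Metric.isOpen_ball.measurableSet.nullMeasurableSet.inter
      (hj.aemeasurable.ennreal_toReal.nullMeasurableSet_preimage measurableSet_Icc)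
  obtain ⟨n, hn⟩ : ∃ n, volume (S n) ≠ 0 := by
    by_contra! h
    refine hj' r hr ?_
    rw [ae_restrict_iff' Metric.isOpen_ball.measurableSet]
    have h1 : ∀ᵐ z, z ∉ ⋃ n, S n := measure_eq_zero_iff_ae_notMem.1 (measure_iUnion_null h)
    filter_upwards [h1, hj.ae_ne_top] with z hz hzt hzr
    by_contra hz0
    have hk := ENNReal.toReal_pos hz0 hzt
    obtain ⟨n₁, hn₁⟩ := exists_nat_one_div_lt hk
    obtain ⟨n₂, hn₂⟩ := exists_nat_gt (j z).toReal
    refine hz (mem_iUnion.2 ⟨max n₁ n₂, hzr, ?_, ?_⟩)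
    · refine le_trans ?_ hn₁.le
      gcongr
      exact_mod_cast le_max_left _ _
    · have : (n₂ : ℝ) ≤ (max n₁ n₂ : ℕ) := by exact_mod_cast le_max_right _ _
      linarith
  obtain ⟨T, hTS, hTm, hT⟩ := (hS n).exists_measurable_subset_ae_eq
  rw [← measure_congr hT] at hn
  obtain ⟨A, hAT, hA, hA0⟩ := hTm.exists_lt_isCompact (pos_iff_ne_zero.2 hn)
  exact ⟨A, hA, fun z hz => (hTS (hAT hz)).1, hA0.ne', 1 / ((n : ℝ) + 1), n + 1, by positivity,
    fun z hz => (hTS (hAT hz)).2⟩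

/-- A nonnegative supersolution either vanishes near a point of `Ω` or is bounded below there. -/
theorem IsWeakSupersolution.eq_zero_near_or_pos_near [NeZero N] (hj : LevyKernel j)
    (hj' : NontrivialNearZero j) (hΩ : IsOpen Ω) (hc : MemLpLocOn c ∞ Ω)
    (hu : IsWeakSupersolution j c Ω u) (hu0 : ∀ᵐ x, 0 ≤ u x) {x : EuclideanSpace ℝ (Fin N)}
    (hx : x ∈ Ω) :
    (∃ ρ : ℝ, 0 < ρ ∧ ∀ᵐ y ∂volume.restrict (Metric.ball x ρ), u y = 0) ∨
    ∃ ρ : ℝ, 0 < ρ ∧ ∃ δ : ℝ, 0 < δ ∧ ∀ᵐ y ∂volume.restrict (Metric.ball x ρ), δ ≤ u y := by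
  refine or_iff_not_imp_right.2 fun hP => ?_
  set P : EuclideanSpace ℝ (Fin N) → Prop := fun x =>
    ∃ ρ : ℝ, 0 < ρ ∧ ∃ δ : ℝ, 0 < δ ∧ ∀ᵐ y ∂volume.restrict (Metric.ball x ρ), δ ≤ u y with hPdef
  have hPu : ∀ᵐ y, P y → 0 < u y := by
    rw [ae_iff]
    refine measure_null_of_locally_null _ fun y hy => ?_
    simp only [mem_ofPred_eq, Classical.not_imp] at hy
    obtain ⟨ρ, hρ, δ, hδ, h⟩ := hy.1
    rw [ae_restrict_iff' Metric.isOpen_ball.measurableSet, ae_iff] at h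
    refine ⟨_, inter_mem_nhdsWithin _ (Metric.ball_mem_nhds y hρ), measure_mono_null ?_ h⟩
    rintro z ⟨hz, hzb⟩
    simp only [mem_ofPred_eq, Classical.not_imp] at hz ⊢
    exact ⟨hzb, fun h => hz.2 (hδ.trans_le h)⟩
  have hum : AEMeasurable u := hu.1.1.locallyIntegrable.aestronglyMeasurable.aemeasurable
  obtain ⟨r, hr, hrΩ⟩ := Metric.isOpen_iff.1 hΩ x hx
  obtain ⟨A, hA, hAr, hA0, a, b, ha, hab⟩ := hj.exists_isCompact_bounds hj' hr
  have h0 : ∫⁻ z in A, ENNReal.ofReal (u (x + z)) = 0 := by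
    by_contra h
    exact hP (hu.exists_pos_le_near hj hΩ hc hu0 hA ha hab hx h)
  have hum' : AEMeasurable (fun z => ENNReal.ofReal (u (x + z))) :=
    (hum.comp_quasiMeasurePreserving (quasiMeasurePreserving_add_left volume x)).ennreal_ofReal
  rw [lintegral_eq_zero_iff' hum'.restrict] at h0
  have hPz : ∀ᵐ z, P (x + z) → 0 < u (x + z) :=
    (quasiMeasurePreserving_add_left volume x).ae hPu
  obtain ⟨ρ, hρ, hball⟩ := exists_ball_ae_eq_zero (μ := volume) hA hA.measurableSet hA0
    hum.ennreal_ofReal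
  refine ⟨ρ, hρ, ?_⟩
  have := hball x ?_
  · filter_upwards [this, ae_restrict_of_ae hu0] with y hy hy0
    exact le_antisymm (ENNReal.ofReal_eq_zero.1 hy) hy0
  · rw [EventuallyEq, ae_restrict_iff' hA.measurableSet] at h0
    rw [ae_restrict_iff' hA.measurableSet]
    -- Since `u > 0` a.e. on `P` while `u = 0` a.e. on `x + A`, almost every `x + z` lies outside
    -- `P`. It lies in `Ω` because `A ⊆ ball 0 r`, so the barrier argument applies there with `-A`,
    -- where evenness gives the same bounds on `j`.
    filter_upwards [h0, hPz] with z hz hPz hzA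
    have hnP : ¬ P (x + z) := fun h => (hPz h).not_ge (ENNReal.ofReal_eq_zero.1 (hz hzA))
    by_contra h
    refine hnP (hu.exists_pos_le_near hj hΩ hc hu0 hA.neg ha (b := b) ?_ (hrΩ ?_) ?_)
    · intro w hw
      rw [← hj.even]
      exact hab _ hw
    · simpa [dist_eq_norm] using hAr hzA
    · convert h using 1
      have := (Measure.measurePreserving_neg (volume : Measure (EuclideanSpace ℝ (Fin N)))).setLIntegral_comp_emb
        (MeasurableEquiv.neg _).measurableEmbedding (fun w => ENNReal.ofReal (u (x + z + w))) A
      rw [image_neg_eq_neg] at this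
      simpa only [sub_eq_add_neg] using this.symm

end StrongMaximumPrinciple

theorem mainTheorem1 {N : ℕ} (j : EuclideanSpace ℝ (Fin N) → ℝ≥0∞)
    (hj1 : LevyKernel j) (hj2 : NontrivialNearZero j)
    (Ω : Set (EuclideanSpace ℝ (Fin N))) (hΩ_open : IsOpen Ω) (hΩ_conn : IsConnected Ω)
    (c : EuclideanSpace ℝ (Fin N) → ℝ) (hc : MemLpLocOn c ∞ Ω)
    (u : EuclideanSpace ℝ (Fin N) → ℝ) (hu : IsWeakSupersolution j c Ω u)
    (hu_nonneg : ∀ᵐ x ∂(volume : Measure (EuclideanSpace ℝ (Fin N))), 0 ≤ u x) :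
    (∀ᵐ x ∂(volume.restrict Ω), u x = 0) ∨ StrictlyPositiveOn u Ω := by
  set Z : Set (EuclideanSpace ℝ (Fin N)) :=
    {x | ∃ ρ : ℝ, 0 < ρ ∧ ∀ᵐ y ∂volume.restrict (Metric.ball x ρ), u y = 0} with hZ
  set P : Set (EuclideanSpace ℝ (Fin N)) :=
    {x | ∃ ρ : ℝ, 0 < ρ ∧ ∃ δ : ℝ, 0 < δ ∧ ∀ᵐ y ∂volume.restrict (Metric.ball x ρ), δ ≤ u y} with hP
  have hcover : Ω ⊆ Z ∪ P := by
    intro x hx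
    -- For `N = 0` the Lévy condition allows `j 0 = ∞`, so the general argument is unavailable; but
    -- the space is a single point and `u` is constant.
    rcases Nat.eq_zero_or_pos N with rfl | hN
    · have hconst : ∀ y, u y = u x := fun y => congrArg u (Subsingleton.elim _ _)
      simp only [hZ, hP, mem_union, mem_ofPred_eq, hconst]
      rw [← hconst x] at *
      obtain ⟨y, hy⟩ := hu_nonneg.exists
      rw [hconst y] at hy
      rcases hy.eq_or_lt with h | h
      · exact Or.inl ⟨1, one_pos, ae_of_all _ fun _ => h.symm⟩
      · exact Or.inr ⟨1, one_pos, u x, h, ae_of_all _ fun _ => le_rfl⟩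
    · have : NeZero N := ⟨hN.ne'⟩
      exact hu.eq_zero_near_or_pos_near hj1 hj2 hΩ_open hc hu_nonneg hx
  have hsub {x y : EuclideanSpace ℝ (Fin N)} {ρ : ℝ} (hy : y ∈ Metric.ball x ρ) :
      0 < ρ - dist y x ∧ Metric.ball y (ρ - dist y x) ⊆ Metric.ball x ρ :=
    ⟨sub_pos.2 hy, Metric.ball_subset_ball' (by linarith)⟩
  have hZo : IsOpen Z := by
    refine Metric.isOpen_iff.2 fun x ⟨ρ, hρ, h⟩ => ⟨ρ, hρ, fun y hy => ?_⟩
    exact ⟨_, (hsub hy).1, ae_restrict_of_ae_restrict_of_subset (hsub hy).2 h⟩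
  have hPo : IsOpen P := by
    refine Metric.isOpen_iff.2 fun x ⟨ρ, hρ, δ, hδ, h⟩ => ⟨ρ, hρ, fun y hy => ?_⟩
    exact ⟨_, (hsub hy).1, δ, hδ, ae_restrict_of_ae_restrict_of_subset (hsub hy).2 h⟩
  have hdisj : Ω ∩ (Z ∩ P) = ∅ := by
    refine eq_empty_of_forall_notMem ?_
    rintro x ⟨-, ⟨ρ₁, hρ₁, h₁⟩, ρ₂, hρ₂, δ, hδ, h₂⟩
    have hle1 : Metric.ball x (min ρ₁ ρ₂) ⊆ Metric.ball x ρ₁ :=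
      Metric.ball_subset_ball (min_le_left _ _)
    have hle2 : Metric.ball x (min ρ₁ ρ₂) ⊆ Metric.ball x ρ₂ :=
      Metric.ball_subset_ball (min_le_right _ _)
    have h := (ae_restrict_of_ae_restrict_of_subset hle1 h₁).and
      (ae_restrict_of_ae_restrict_of_subset hle2 h₂)
    have hne : volume.restrict (Metric.ball x (min ρ₁ ρ₂)) ≠ 0 := by
      rw [Ne, Measure.restrict_eq_zero]
      exact (Metric.measure_ball_pos _ _ (lt_min hρ₁ hρ₂)).ne'
    have : (ae (volume.restrict (Metric.ball x (min ρ₁ ρ₂)))).NeBot := ae_neBot.2 hne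
    obtain ⟨y, hy1, hy2⟩ := h.exists
    linarith
  rcases isPreconnected_iff_subset_of_disjoint.1 hΩ_conn.isPreconnected Z P hZo hPo hcover hdisj
    with h | h
  · left
    rw [ae_restrict_iff' hΩ_open.measurableSet, ae_iff]
    refine measure_null_of_locally_null _ fun y hy => ?_
    simp only [mem_ofPred_eq, Classical.not_imp] at hy
    obtain ⟨ρ, hρ, h0⟩ := h hy.1
    rw [ae_restrict_iff' Metric.isOpen_ball.measurableSet, ae_iff] at h0
    refine ⟨_, inter_mem_nhdsWithin _ (Metric.ball_mem_nhds y hρ), measure_mono_null ?_ h0⟩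
    rintro z ⟨hz, hzb⟩
    simp only [mem_ofPred_eq, Classical.not_imp] at hz ⊢
    exact ⟨hzb, hz.2⟩
  · right
    intro K hK hKΩ
    obtain ⟨δ, hδ, hδK⟩ : ∃ δ : ℝ, 0 < δ ∧ ∀ᵐ y ∂volume.restrict K, δ ≤ u y := by
      refine hK.induction_on (p := fun s => ∃ δ : ℝ, 0 < δ ∧ ∀ᵐ y ∂volume.restrict s, δ ≤ u y)
        ⟨1, one_pos, by simp⟩ ?_ ?_ ?_
      · rintro s t hst ⟨δ, hδ, h⟩
        exact ⟨δ, hδ, ae_restrict_of_ae_restrict_of_subset hst h⟩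
      · rintro s t ⟨δ₁, hδ₁, h₁⟩ ⟨δ₂, hδ₂, h₂⟩
        refine ⟨min δ₁ δ₂, lt_min hδ₁ hδ₂, ae_restrict_union_iff _ _ _ |>.2 ⟨?_, ?_⟩⟩
        · exact h₁.mono fun y hy => (min_le_left _ _).trans hy
        · exact h₂.mono fun y hy => (min_le_right _ _).trans hy
      · intro x hx
        obtain ⟨ρ, hρ, δ, hδ, hb⟩ := h (hKΩ hx)
        exact ⟨_, mem_nhdsWithin_of_mem_nhds (Metric.ball_mem_nhds x hρ), δ, hδ, hb⟩
    refine lt_of_lt_of_le (EReal.coe_pos.2 hδ) (le_essInf_of_ae_le _ ?_)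
    filter_upwards [hδK] with y hy
    exact EReal.coe_le_coe_iff.2 hy
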